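/- **Setting.** There are $n$ buyers $[n]$ and $m$ items $[m]$. Buyer $i$ has a valuation $v_i : 2^{[m]} \to \mathbb{R}_{\ge 0}$ with $v_i(\emptyset)=0$ that is monotone ($v_i(S)\le v_i(T)$ for $S\subseteq T$). The valuation $v_i$ is *submodular* if $v_i(A\cup\{j\})-v_i(A)\ge v_i(B\cup\{j\})-v_i(B)$ for all $A\subseteq B\subseteq[m]$ and $j\in[m]\setminus B$, and *XOS* if there are finitely many additive functions $a_1,\dots,a_k$ with nonnegative item values such that $v_i(B)=\max_{\ell}\sum_{j\in B}a_\ell(j)$ for all $B\subseteq[m]$. Let $\mathrm{OPT}(\mathbf v)$ be the maximum of $\sum_{i\in[n]} v_i(A_i)$ over all families of pairwise disjoint bundles $A_1,\dots,A_n\subseteq[m]$. An *order-oblivious secretary algorithm* knows $n$ and $m$ and may be randomized. It fixes a (possibly random) sample size $k\in\{0,\dots,n\}$; then a uniformly random set $S\subseteq[n]$ of $k$ buyers is drawn and the valuations $v_i$, $i\in S$, are revealed to the algorithm. Sampled buyers receive nothing. The buyers in $[n]\setminus S$ then arrive one by one in an adversarial order. When a buyer arrives, its identity and valuation are revealed,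 and the algorithm immediately and irrevocably gives it a bundle of items not allocated so far, depending only on its own random choices, the sample, and the arrivals up to and including this one. The algorithm is *$\alpha$-competitive* for submodular and XOS buyers if for every profile $\mathbf v$ in which each $v_i$ is submodular or XOS, and for every arrival order of the unsampled buyers (which may depend on $\mathbf v$, on $S$ and on the random choices of the algorithm), its expected welfare is at least $\frac1\alpha\,\mathrm{OPT}(\mathbf v)$. **Statement.** There is an absolute constant $\alpha\ge 1$ such that for all $n$ and $m$ there is an $\alpha$-competitive order-oblivious secretary algorithm for online combinatorial allocation with $n$ submodular or XOS buyers and $m$ items. Moreover, the algorithm samples a constant fraction of the buyers, in the sense that its sample size is distributed as $\mathrm{Binomial}(n,1/2)$, i.e. each buyer belongs to the sample independently with probability $1/2$. -/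

import Mathlib

namespace OrderObliviousSecretary

/-- A normalized monotone valuation on bundles of the items `Fin m`
(hence with nonnegative values). -/
structure Valuation (m : ℕ) where
  val : Finset (Fin m) → ℝ
  val_empty : val ∅ = 0
  mono : ∀ ⦃S T : Finset (Fin m)⦄, S ⊆ T → val S ≤ val T

/-- `v` is XOS: a pointwise maximum of a finite collection of nonnegative additive functions. -/
def Valuation.IsXOS {m : ℕ} (v : Valuation m) : Prop :=
  ∃ (k : ℕ) (a : Fin k → Fin m → ℝ), (∀ l j, 0 ≤ a l j) ∧
    ∀ B : Finset (Fin m), IsGreatest (Set.range fun l => ∑ j ∈ B, a l j) (v.val B)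

/-- `v` is submodular: decreasing marginal values. -/
def Valuation.IsSubmodular {m : ℕ} (v : Valuation m) : Prop :=
  ∀ A B : Finset (Fin m), A ⊆ B → ∀ j, j ∉ B →
    v.val (insert j B) - v.val B ≤ v.val (insert j A) - v.val A

/-- Assignments of pairwise disjoint bundles to the buyers `Fin n`. -/
def Allocation (n m : ℕ) : Type :=
  {A : Fin n → Finset (Fin m) // ∀ i j, i ≠ j → Disjoint (A i) (A j)}

/-- The offline optimal welfare (a supremum over a finite nonempty set, hence a maximum). -/
noncomputable def optWelfare {n m : ℕ} (v : Fin n → Valuation m) : ℝ :=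
  ⨆ A : Allocation n m, ∑ i, (v i).val (A.1 i)

/-- An arrival: the buyer together with the valuation it reveals. -/
abbrev Arrival (n m : ℕ) : Type := Fin n × Valuation m

/-- A randomized order-oblivious secretary algorithm for `n` buyers and `m` items.
It draws a seed, which fixes the sample size. After it has seen the valuations of a sample of that
size (`obs i = some (v i)` for the sampled buyers, `none` for the others), `request` gives the
bundle it selects for the currently arriving buyer, as a function of the seed, the sample, the
earlier arrivals (most recent first) and the current arrival only. -/
structure Algorithm (n m : ℕ) where
  Seed : Type
  [fintypeSeed : Fintype Seed]
  prob : Seed → ℝ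
  prob_nonneg : ∀ ω, 0 ≤ prob ω
  prob_sum : ∑ ω, prob ω = 1
  sampleSize : Seed → ℕ
  sampleSize_le : ∀ ω, sampleSize ω ≤ n
  request : Seed → (obs : Fin n → Option (Valuation m)) → (past : List (Arrival n m)) →
    (current : Arrival n m) → Finset (Fin m)

attribute [instance] Algorithm.fintypeSeed

namespace Algorithm

variable {n m : ℕ} (alg : Algorithm n m)

/-- The items allocated during a list of arrivals (most recent first). -/
def taken (ω : alg.Seed) (obs : Fin n → Option (Valuation m)) :
    List (Arrival n m) → Finset (Fin m)
  | [] => ∅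
  | x :: past => taken ω obs past ∪ alg.request ω obs past x

/-- The bundle irrevocably allocated to the current arrival: the still available part of the
requested bundle. -/
def bundle (ω : alg.Seed) (obs : Fin n → Option (Valuation m)) (past : List (Arrival n m))
    (x : Arrival n m) : Finset (Fin m) :=
  alg.request ω obs past x \ alg.taken ω obs past

/-- The welfare collected during a list of arrivals (most recent first). -/
def welfare (ω : alg.Seed) (obs : Fin n → Option (Valuation m)) : List (Arrival n m) → ℝ
  | [] => 0
  | x :: past => welfare ω obs past + x.2.val (alg.bundle ω obs past x)

end Algorithm

/-- What the sample `S` reveals about the valuation profile `v`. -/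
def observe {n m : ℕ} (v : Fin n → Valuation m) (S : Finset (Fin n)) :
    Fin n → Option (Valuation m) :=
  fun i => if i ∈ S then some (v i) else none

/-- `L` lists the buyers outside the sample `S`, each once, in order of arrival. -/
def IsArrivalOrder {n : ℕ} (S : Finset (Fin n)) (L : List (Fin n)) : Prop :=
  L.Nodup ∧ ∀ i, i ∈ L ↔ i ∉ S

/-- The expected welfare on the profile `v`: the seed is drawn, then a uniformly random set `S` of
`sampleSize` buyers is revealed, and the buyers outside `S` arrive in the order `order ω S`. -/
noncomputable def expectedWelfare {n m : ℕ} (alg : Algorithm n m) (v : Fin n → Valuation m)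
    (order : alg.Seed → Finset (Fin n) → List (Fin n)) : ℝ :=
  ∑ ω, alg.prob ω *
    ((∑ S ∈ Finset.powersetCard (alg.sampleSize ω) Finset.univ,
        alg.welfare ω (observe v S) ((order ω S).map fun i => (i, v i)).reverse)
      / (n.choose (alg.sampleSize ω) : ℝ))

/-- `alg` is `α`-competitive on submodular and XOS buyers, against all valuations of all buyers
(including the sampled ones) and every arrival order of the unsampled buyers. The order may depend
on the valuations, on the sample and on the seed, which covers adaptive adversaries. -/
def IsCompetitive {n m : ℕ} (alg : Algorithm n m) (α : ℝ) : Prop :=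
  ∀ v : Fin n → Valuation m, (∀ i, (v i).IsSubmodular ∨ (v i).IsXOS) →
    ∀ order : alg.Seed → Finset (Fin n) → List (Fin n),
      (∀ ω S, IsArrivalOrder S (order ω S)) →
        optWelfare v ≤ α * expectedWelfare alg v order

/-- The sample size is distributed as `Binomial(n, 1/2)`: equivalently, every buyer is in the
sample independently with probability `1/2`. -/
def SamplesHalf {n m : ℕ} (alg : Algorithm n m) : Prop :=
  ∀ k : ℕ, (∑ ω, if alg.sampleSize ω = k then alg.prob ω else 0) = (n.choose k : ℝ) / 2 ^ n

end OrderObliviousSecretary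

/-!
Every submodular valuation is XOS, so let all buyers be XOS. Besides the sample `S`, draw an
independent uniformly random set `C` of candidates.

The buyers in `S \ C` set item prices: in a fixed order, each one takes an additive function
supporting its valuation at a favourite bundle and raises the prices to it. The final prices sum to
at least half the optimal welfare of `S \ C`, hence on average to at least `OPT / 8`.

The price of an item is the highest of the bids of the buyers in `S \ C`. Since the bid of a buyer
depends only on which of the earlier buyers are in `S \ C`, it would be the same were that buyer a
candidate instead, and on average the highest bid among the candidates is at least half the price.

Given `C`, the bids depend on `S \ C` only. So with probability at least `1/4` the highest candidate
is not in the sample but the second highest one is. Then the highest candidate is the only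
unsampled one to beat the sampled candidates, and gets the item in every arrival order. Its bids
form an additive lower bound on its valuation, so the expected welfare is at least
`OPT / (8 * 2 * 4)`.
-/

open Finset
open scoped BigOperators NNReal

namespace OrderObliviousSecretary

section Toggling

theorem symmDiff_singleton_sdiff {ι : Type*} [DecidableEq ι] {N : Finset ι} {a : ι} (ha : a ∈ N)
    (S : Finset ι) :
    symmDiff S {a} \ N = S \ N := by
  ext l
  have : l ∉ N → l ≠ a := fun hl => (ne_of_mem_of_not_mem ha hl).symm
  simp only [mem_sdiff, mem_symmDiff, mem_singleton]
  tauto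

variable {ι M : Type*} [Fintype ι] [DecidableEq ι] [AddCommMonoid M] [Module ℚ≥0 M]
  {e : Finset ι → ι} {f : Finset ι → M}

-- Toggling the membership of `e S` in `S` is an involution.
theorem expect_ite_mem_eq_expect_ite_notMem (he : ∀ S, e (symmDiff S {e S}) = e S)
    (hf : ∀ S, f (symmDiff S {e S}) = f S) :
    𝔼 S, (if e S ∈ S then f S else 0) = 𝔼 S, if e S ∉ S then f S else 0 := by
  have toggle_involutive : Function.Involutive fun S : Finset ι => symmDiff S {e S} := fun S => by
    simp only [he, symmDiff_symmDiff_cancel_right]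
  exact Fintype.expect_equiv toggle_involutive.toPerm _ _ fun S => by
    simp [he, hf, mem_symmDiff]

theorem two_nsmul_expect_ite_mem (he : ∀ S, e (symmDiff S {e S}) = e S)
    (hf : ∀ S, f (symmDiff S {e S}) = f S) :
    2 • 𝔼 S, (if e S ∈ S then f S else 0) = 𝔼 S, f S := by
  rw [two_nsmul]
  nth_rw 2 [expect_ite_mem_eq_expect_ite_notMem he hf]
  rw [← expect_add_distrib]
  exact expect_congr rfl fun S _ => by split_ifs <;> simp

theorem two_nsmul_expect_ite_notMem (he : ∀ S, e (symmDiff S {e S}) = e S)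
    (hf : ∀ S, f (symmDiff S {e S}) = f S) :
    2 • 𝔼 S, (if e S ∉ S then f S else 0) = 𝔼 S, f S := by
  rw [← expect_ite_mem_eq_expect_ite_notMem he hf, two_nsmul_expect_ite_mem he hf]

end Toggling

section RandomSubsets

variable {ι M : Type*} [Fintype ι] [AddCommMonoid M] [Module ℚ≥0 M]

theorem two_nsmul_expect_sum (c : ι → M) : 2 • 𝔼 S : Finset ι, ∑ i ∈ S, c i = ∑ i, c i := by
  classical
  have sum_mem (S : Finset ι) : ∑ i ∈ S, c i = ∑ i, if i ∈ S then c i else 0 := by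
    rw [sum_ite_mem, univ_inter]
  rw [expect_congr rfl fun S _ => sum_mem S, expect_sum_comm, smul_sum]
  refine sum_congr rfl fun i _ => ?_
  rw [two_nsmul_expect_ite_mem (e := fun _ => i) (f := fun _ => c i) (fun _ => rfl) fun _ => rfl,
    Fintype.expect_const]

theorem two_nsmul_expect_sum_sdiff [DecidableEq ι] (T : Finset ι) (c : ι → M) :
    2 • 𝔼 C, ∑ i ∈ T \ C, c i = ∑ i ∈ T, c i := by
  simp only [sdiff_eq_filter, sum_filter, expect_sum_comm, smul_sum]
  refine sum_congr rfl fun i _ => ?_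
  rw [two_nsmul_expect_ite_notMem (e := fun _ => i) (f := fun _ => c i) (fun _ => rfl)
    fun _ => rfl, Fintype.expect_const]

theorem expect_expect_powersetCard_card (g : Finset ι → M) :
    𝔼 T : Finset ι, 𝔼 S ∈ powersetCard #T univ, g S = 𝔼 S, g S := by
  have sum_eq : ∑ T : Finset ι, 𝔼 S ∈ powersetCard #T univ, g S = ∑ S, g S := by
    rw [← powerset_univ, sum_powerset_apply_card (fun k => 𝔼 S ∈ powersetCard k univ, g S),
      sum_powerset]
    refine sum_congr rfl fun k _ => ?_
    rw [← card_powersetCard, card_smul_expect]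
  rw [expect_univ, expect_univ, sum_eq]

end RandomSubsets

section RunningMaximum

variable {ι : Type*} [Fintype ι] [LinearOrder ι]

-- Toggling the largest element `a` of `s` changes neither `x C a` nor the maximum over the
-- elements below `a`, so half of the expected increment at `a` comes from the sets containing `a`.
theorem expect_sup_le_two_mul_expect_sup_inter {x : Finset ι → ι → ℝ≥0}
    (hx : ∀ C D i, (∀ l < i, l ∈ C ↔ l ∈ D) → x C i = x D i) (s : Finset ι) :
    𝔼 C, s.sup (x C) ≤ 2 * 𝔼 C, (s ∩ C).sup (x C) := by
  induction s using Finset.induction_on_max with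
  | empty => simp
  | insert a s hlt ih =>
    have hx_toggle (C : Finset ι) {i : ι} (hi : i ≤ a) : x (symmDiff C {a}) i = x C i :=
      hx _ _ i fun l hl => by simp [mem_symmDiff, (hl.trans_le hi).ne]
    have hsup_toggle (C : Finset ι) : s.sup (x (symmDiff C {a})) = s.sup (x C) :=
      sup_congr rfl fun i hi => hx_toggle C (hlt i hi).le
    have sup_insert_inter (C : Finset ι) : (insert a s ∩ C).sup (x C) =
        (s ∩ C).sup (x C) + if a ∈ C then x C a - (s ∩ C).sup (x C) else 0 := by
      split_ifs with ha
      · rw [insert_inter_of_mem ha, sup_insert, add_tsub_eq_max, sup_comm]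
      · rw [insert_inter_of_notMem ha, add_zero]
    calc 𝔼 C, (insert a s).sup (x C)
        = 𝔼 C, s.sup (x C) + 𝔼 C, (x C a - s.sup (x C)) := by
          simp only [sup_insert, ← expect_add_distrib, add_tsub_eq_max, sup_comm]
      _ = 𝔼 C, s.sup (x C) + 2 * 𝔼 C, if a ∈ C then x C a - s.sup (x C) else 0 := by
          rw [← two_nsmul_expect_ite_mem (e := fun _ => a)
            (f := fun C => x C a - s.sup (x C)) (fun _ => rfl)
            fun C => by simp only [hx_toggle C le_rfl, hsup_toggle], nsmul_eq_mul, Nat.cast_ofNat]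
      _ ≤ 2 * 𝔼 C, (s ∩ C).sup (x C) +
          2 * 𝔼 C, if a ∈ C then x C a - (s ∩ C).sup (x C) else 0 := by
          gcongr with C
          split_ifs
          · exact tsub_le_tsub_left (sup_mono inter_subset_left) _
          · exact le_rfl
      _ = 2 * 𝔼 C, (insert a s ∩ C).sup (x C) := by
          simp only [sup_insert_inter, expect_add_distrib, mul_add]

end RunningMaximum

section SampledSecondPrice

variable {ι : Type*}

/-- The pair `(x i, i)`, ordered lexicographically: candidates are compared by value, with ties
broken by index. -/
def rank (x : ι → ℝ≥0) (i : ι) : ℝ≥0 ×ₗ ι := toLex (x i, i)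

theorem rank_injective (x : ι → ℝ≥0) : Function.Injective (rank x) := fun _ _ h =>
  congrArg (fun z => (ofLex z).2) h

variable [LinearOrder ι]

theorem le_of_rank_le {x : ι → ℝ≥0} {i l : ι} (h : rank x i ≤ rank x l) : x i ≤ x l :=
  Prod.Lex.monotone_fst _ _ h

theorem exists_top_rank {N : Finset ι} (hN : N.Nonempty) (x : ι → ℝ≥0) :
    ∃ a ∈ N, ∀ l ∈ N, l ≠ a → rank x l < rank x a := by
  obtain ⟨a, ha, hmax⟩ := exists_max_image N (rank x) hN
  exact ⟨a, ha, fun l hl hla => (hmax l hl).lt_of_ne ((rank_injective x).ne hla)⟩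

/-- The candidate `i ∈ N` has a higher rank than every sampled candidate. -/
def BeatsSample (N S : Finset ι) (x : ι → ℝ≥0) (i : ι) : Prop :=
  i ∈ N ∧ ∀ l ∈ N, l ∈ S → rank x l < rank x i

theorem beatsSample_congr {N S : Finset ι} {x y : ι → ℝ≥0} {i : ι}
    (h : ∀ l ∈ insert i S, x l = y l) : BeatsSample N S x i ↔ BeatsSample N S y i := by
  refine and_congr_right fun _ => forall₃_congr fun l _ hl => ?_
  rw [rank, rank, rank, rank, h l (mem_insert_of_mem hl), h i (mem_insert_self i S)]

/-- The candidate `i` is the only unsampled one that beats the sample. It therefore gets the item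
in every arrival order when the first candidate to beat the sample is served. -/
def IsSoleWinner (N S : Finset ι) (x : ι → ℝ≥0) (i : ι) : Prop :=
  i ∉ S ∧ BeatsSample N S x i ∧ ∀ l, l ∉ S → BeatsSample N S x l → l = i

theorem isSoleWinner_of_top_of_dominated {N S : Finset ι} {x : ι → ℝ≥0} {a : ι} (haN : a ∈ N)
    (haS : a ∉ S) (htop : ∀ l ∈ N, l ≠ a → rank x l < rank x a)
    (hdom : ∀ l ∈ N, l ≠ a → ∃ b ∈ N, b ∈ S ∧ rank x l ≤ rank x b) : IsSoleWinner N S x a := by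
  refine ⟨haS, ⟨haN, fun l hl hlS => htop l hl (ne_of_mem_of_not_mem hlS haS)⟩, fun l _ hl => ?_⟩
  by_contra hla
  obtain ⟨b, hbN, hbS, hlb⟩ := hdom l hl.1 hla
  exact (hl.2 b hbN hbS).not_ge hlb

variable [Fintype ι]

open Classical in
/-- The value of the sole winner, or `0` if there is none. -/
noncomputable def soleWinnerValue (N S : Finset ι) (x : ι → ℝ≥0) : ℝ≥0 :=
  ∑ i with IsSoleWinner N S x i, x i

theorem IsSoleWinner.le_soleWinnerValue {N S : Finset ι} {x : ι → ℝ≥0} {i : ι}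
    (h : IsSoleWinner N S x i) : x i ≤ soleWinnerValue N S x := by
  classical exact single_le_sum_of_canonicallyOrdered (mem_filter.2 ⟨mem_univ i, h⟩)

theorem expect_ite_top_notMem_le {N : Finset ι} {x : Finset ι → ι → ℝ≥0} {a : Finset ι → ι}
    (haN : ∀ T, a T ∈ N) (htop : ∀ T, ∀ l ∈ N, l ≠ a T → rank (x T) l < rank (x T) (a T)) :
    𝔼 S, (if a (S \ N) ∉ S then x (S \ N) (a (S \ N)) else 0) ≤
      2 * 𝔼 S, soleWinnerValue N S (x (S \ N)) := by
  by_cases hN : N.Nontrivial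
  · have hrest (T : Finset ι) : (N.erase (a T)).Nonempty := hN.erase_nonempty
    choose b hb hsecond using fun T => exists_top_rank (hrest T) (x T)
    have hbN (T : Finset ι) : b T ∈ N := mem_of_mem_erase (hb T)
    have hab (T : Finset ι) : a T ≠ b T := (ne_of_mem_erase (hb T)).symm
    rw [← two_nsmul_expect_ite_mem (e := fun S => b (S \ N))
      (fun S => by rw [symmDiff_singleton_sdiff (hbN _)])
      fun S => by simp [symmDiff_singleton_sdiff (hbN _), mem_symmDiff, hab],
      nsmul_eq_mul, Nat.cast_ofNat]
    gcongr with S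
    split_ifs with hbS haS
    · exact zero_le
    · refine (isSoleWinner_of_top_of_dominated (haN _) haS (htop _)
        fun l hl hla => ⟨_, hbN _, hbS, ?_⟩).le_soleWinnerValue
      rcases eq_or_ne l (b (S \ N)) with rfl | hlb
      · exact le_rfl
      · exact (hsecond _ l (mem_erase.2 ⟨hla, hl⟩) hlb).le
    · exact zero_le
  · have hsingle (T : Finset ι) : ∀ l ∈ N, l = a T := fun l hl =>
      by_contra fun hne => hN ⟨l, hl, a T, haN T, hne⟩
    refine le_trans ?_ (le_mul_of_one_le_left zero_le one_le_two)
    gcongr with S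
    split_ifs with haS
    · exact zero_le
    · exact (isSoleWinner_of_top_of_dominated (haN _) haS (htop _)
        fun l hl hla => absurd (hsingle _ l hl) hla).le_soleWinnerValue

-- With probability `1/4` the best candidate is not sampled but the second best one is.
theorem expect_sup_le_four_mul_expect_soleWinnerValue (N : Finset ι) (x : Finset ι → ι → ℝ≥0) :
    𝔼 S, N.sup (x (S \ N)) ≤ 4 * 𝔼 S, soleWinnerValue N S (x (S \ N)) := by
  rcases N.eq_empty_or_nonempty with rfl | hN
  · simp
  choose a haN htop using fun T => exists_top_rank hN (x T)
  calc 𝔼 S, N.sup (x (S \ N)) ≤ 𝔼 S, x (S \ N) (a (S \ N)) := by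
        gcongr with S
        refine Finset.sup_le fun l hl => ?_
        rcases eq_or_ne l (a (S \ N)) with rfl | hla
        · exact le_rfl
        · exact le_of_rank_le (htop _ l hl hla).le
    _ = 2 * 𝔼 S, if a (S \ N) ∉ S then x (S \ N) (a (S \ N)) else 0 := by
        rw [← two_nsmul_expect_ite_notMem (e := fun S => a (S \ N))
          (fun S => by rw [symmDiff_singleton_sdiff (haN _)])
          fun S => by rw [symmDiff_singleton_sdiff (haN _)], nsmul_eq_mul, Nat.cast_ofNat]
    _ ≤ 2 * (2 * 𝔼 S, soleWinnerValue N S (x (S \ N))) := by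
        gcongr
        exact expect_ite_top_notMem_le haN htop
    _ = 4 * 𝔼 S, soleWinnerValue N S (x (S \ N)) := by ring

end SampledSecondPrice

section Valuations

variable {m : ℕ} {v : Valuation m}

namespace Valuation

theorem isXOS_iff_exists_supporting : v.IsXOS ↔ ∀ D : Finset (Fin m), ∃ a : Fin m → ℝ,
    (∀ j, 0 ≤ a j) ∧ ∑ j ∈ D, a j = v.val D ∧ ∀ B, ∑ j ∈ B, a j ≤ v.val B := by
  constructor
  · rintro ⟨k, a, ha, hmax⟩ D
    obtain ⟨l, hl⟩ := (hmax D).1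
    exact ⟨a l, ha l, hl, fun B => (hmax B).2 ⟨l, rfl⟩⟩
  · intro h
    choose a ha hsum hle using h
    let e := (Fintype.equivFin (Finset (Fin m))).symm
    refine ⟨_, fun l => a (e l), fun l => ha (e l), fun B => ⟨⟨e.symm B, ?_⟩, ?_⟩⟩
    · simp only [e.apply_symm_apply, hsum]
    · rintro _ ⟨l, rfl⟩
      exact hle (e l) B

/-- The marginal value of the item `j` when the items of `D` are added in increasing order; it
vanishes for `j ∉ D`. These are the item values of a supporting additive function of a submodular
valuation at `D`. -/
def marginal (v : Valuation m) (D : Finset (Fin m)) (j : Fin m) : ℝ :=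
  v.val {l ∈ D | l ≤ j} - v.val {l ∈ D | l < j}

theorem marginal_nonneg (v : Valuation m) (D : Finset (Fin m)) (j : Fin m) :
    0 ≤ v.marginal D j :=
  sub_nonneg.2 (v.mono (monotone_filter_right D fun _ _ h => h.le))

theorem marginal_of_notMem {D : Finset (Fin m)} {j : Fin m} (hj : j ∉ D) :
    v.marginal D j = 0 := by
  have : ({l ∈ D | l ≤ j} : Finset (Fin m)) = {l ∈ D | l < j} :=
    filter_congr fun l hl => (ne_of_mem_of_not_mem hl hj).le_iff_lt
  rw [marginal, this, sub_self]

theorem marginal_of_mem {D : Finset (Fin m)} {j : Fin m} (hj : j ∈ D) :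
    v.marginal D j = v.val (insert j {l ∈ D | l < j}) - v.val {l ∈ D | l < j} := by
  have : ({l ∈ D | l ≤ j} : Finset (Fin m)) = insert j {l ∈ D | l < j} := by
    ext l
    rcases eq_or_ne l j with rfl | hlj
    · simp [hj]
    · simp [hlj, hlj.le_iff_lt]
  rw [marginal, this]

theorem sum_marginal (v : Valuation m) (D : Finset (Fin m)) :
    ∑ j ∈ D, v.marginal D j = v.val D := by
  induction D using Finset.induction_on_max with
  | empty => simp [v.val_empty]
  | insert a D hlt ih =>
    have ha : a ∉ D := fun h => (hlt a h).false
    have marginal_insert : ∀ j ∈ D, v.marginal (insert a D) j = v.marginal D j := fun j hj => by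
      simp only [marginal, filter_insert, (hlt j hj).not_ge, (hlt j hj).not_gt, if_false]
    have filter_lt : ({l ∈ insert a D | l < a} : Finset (Fin m)) = D := by
      rw [filter_insert, if_neg (lt_irrefl a), filter_true_of_mem hlt]
    rw [sum_insert ha, sum_congr rfl marginal_insert, ih, marginal_of_mem (mem_insert_self a D),
      filter_lt, sub_add_cancel]

theorem IsSubmodular.sum_marginal_le (hv : v.IsSubmodular) (D B : Finset (Fin m)) :
    ∑ j ∈ B, v.marginal D j ≤ v.val (D ∩ B) := by
  induction B using Finset.induction_on_max with
  | empty => simp [v.val_empty]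
  | insert b B hlt ih =>
    have hb : b ∉ B := fun h => (hlt b h).false
    rw [sum_insert hb]
    by_cases hbD : b ∈ D
    · have hsub : D ∩ B ⊆ {l ∈ D | l < b} := fun l hl =>
        mem_filter.2 ⟨(mem_inter.1 hl).1, hlt l (mem_inter.1 hl).2⟩
      have decreasing := hv _ _ hsub b (by simp)
      rw [marginal_of_mem hbD, inter_insert_of_mem hbD]
      linarith
    · rwa [marginal_of_notMem hbD, zero_add, inter_insert_of_notMem hbD]

theorem IsSubmodular.isXOS (hv : v.IsSubmodular) : v.IsXOS :=
  isXOS_iff_exists_supporting.2 fun D => ⟨v.marginal D, v.marginal_nonneg D, v.sum_marginal D,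
    fun B => (hv.sum_marginal_le D B).trans (v.mono inter_subset_right)⟩

end Valuation

/-- `w` is an additive lower bound on `v` such that raising the item prices from `p` to `p ⊔ w`
pays for the utility that any bundle has at the prices `p`. -/
structure IsDemandSupport (v : Valuation m) (p w : Fin m → ℝ≥0) : Prop where
  sum_le_val : ∀ B, ∑ j ∈ B, (w j : ℝ) ≤ v.val B
  val_le : ∀ O, v.val O ≤ ∑ j ∈ O, (p j : ℝ) + ∑ j, ((w j - p j : ℝ≥0) : ℝ)

-- `w` is a supporting additive function at a bundle `D` of maximal utility, restricted to `D`.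
theorem exists_isDemandSupport (hv : v.IsXOS) (p : Fin m → ℝ≥0) : ∃ w, IsDemandSupport v p w := by
  obtain ⟨D, -, hD⟩ := exists_max_image (univ : Finset (Finset (Fin m)))
    (fun D => v.val D - ∑ j ∈ D, (p j : ℝ)) univ_nonempty
  obtain ⟨a, ha, hsum, hle⟩ := Valuation.isXOS_iff_exists_supporting.1 hv D
  lift a to Fin m → ℝ≥0 using ha
  refine ⟨a, hle, fun O => ?_⟩
  have utility_le := calc
    v.val O - ∑ j ∈ O, (p j : ℝ) ≤ v.val D - ∑ j ∈ D, (p j : ℝ) := hD O (mem_univ O)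
    _ = ∑ j ∈ D, ((a j : ℝ) - p j) := by rw [sum_sub_distrib, hsum]
    _ ≤ ∑ j ∈ D, ((a j - p j : ℝ≥0) : ℝ) :=
      sum_le_sum fun j _ => NNReal.coe_sub_def.symm ▸ le_max_left _ _
    _ ≤ ∑ j, ((a j - p j : ℝ≥0) : ℝ) :=
      sum_le_sum_of_subset_of_nonneg (subset_univ D) fun j _ _ => NNReal.coe_nonneg _
  linarith

/-- A demand support of `v` at the prices `p`, chosen arbitrarily; a junk value if there is
none. -/
noncomputable def demandSupport (v : Valuation m) (p : Fin m → ℝ≥0) : Fin m → ℝ≥0 :=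
  Classical.epsilon (IsDemandSupport v p)

theorem isDemandSupport_demandSupport (hv : v.IsXOS) (p : Fin m → ℝ≥0) :
    IsDemandSupport v p (demandSupport v p) :=
  Classical.epsilon_spec (exists_isDemandSupport hv p)

end Valuations

section Prices

variable {ι : Type*} [LinearOrder ι] {m : ℕ}

/-- The item prices after the buyers in `H`, in increasing order, have each raised them to their
demand support at the prices they found. -/
noncomputable def price (v : ι → Valuation m) (H : Finset ι) : Fin m → ℝ≥0 :=
  (H.sort (· ≥ ·)).foldr (fun i p => p ⊔ demandSupport (v i) p) 0

/-- The item values with which buyer `i` competes, given that the buyers in `H` set the prices: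
the demand support at the prices that `i` finds. -/
noncomputable def bid (v : ι → Valuation m) (H : Finset ι) (i : ι) : Fin m → ℝ≥0 :=
  demandSupport (v i) (price v {l ∈ H | l < i})

theorem price_insert (v : ι → Valuation m) {H : Finset ι} {a : ι} (ha : ∀ l ∈ H, l < a) :
    price v (insert a H) = price v H ⊔ demandSupport (v a) (price v H) := by
  rw [price, sort_insert _ (fun l hl => (ha l hl).le) fun h => (ha a h).false, List.foldr_cons]
  rfl

theorem price_congr {v v' : ι → Valuation m} {H : Finset ι} (h : ∀ i ∈ H, v i = v' i) :
    price v H = price v' H :=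
  List.foldr_ext _ _ _ fun i hi _ => by rw [h i ((mem_sort _).1 hi)]

theorem bid_congr {v v' : ι → Valuation m} {H : Finset ι} {i : ι}
    (h : ∀ l ∈ insert i H, v l = v' l) : bid v H i = bid v' H i := by
  rw [bid, bid, h i (mem_insert_self i H),
    price_congr fun l hl => h l (mem_insert_of_mem (mem_of_mem_filter l hl))]

theorem bid_congr_of_lt (v : ι → Valuation m) {H H' : Finset ι} {i : ι}
    (h : ∀ l < i, l ∈ H ↔ l ∈ H') : bid v H i = bid v H' i := by
  have : ({l ∈ H | l < i} : Finset ι) = {l ∈ H' | l < i} := by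
    ext l
    simpa only [mem_filter, and_congr_left_iff] using h l
  rw [bid, bid, this]

theorem price_eq_sup_bid (v : ι → Valuation m) (H : Finset ι) : price v H = H.sup (bid v H) := by
  induction H using Finset.induction_on_max with
  | empty =>
    rw [price, sort_empty, List.foldr_nil, sup_empty]
    rfl
  | insert a H hlt ih =>
    have bid_insert : ∀ i ≤ a, bid v (insert a H) i = bid v H i := fun i hi =>
      bid_congr_of_lt v fun l hl => by simp [(hl.trans_le hi).ne]
    have bid_self : bid v H a = demandSupport (v a) (price v H) := by
      rw [bid, filter_true_of_mem hlt]
    rw [price_insert v hlt, sup_insert, bid_insert a le_rfl, bid_self,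
      sup_congr rfl fun i hi => bid_insert i (hlt i hi).le, ← ih, sup_comm]

theorem sum_val_le_sum_price_add_sum_price {v : ι → Valuation m} (hv : ∀ i, (v i).IsXOS)
    (H : Finset ι) (A : ι → Finset (Fin m)) :
    ∑ i ∈ H, (v i).val (A i) ≤
      ∑ i ∈ H, ∑ j ∈ A i, (price v H j : ℝ) + ∑ j, (price v H j : ℝ) := by
  induction H using Finset.induction_on_max with
  | empty => simp [price]
  | insert a H hlt ih =>
    have ha : a ∉ H := fun h => (hlt a h).false
    have hsupport := (isDemandSupport_demandSupport (hv a) (price v H)).val_le (A a)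
    have price_mono (j : Fin m) : (price v H j : ℝ) ≤ price v (insert a H) j := by
      rw [price_insert v hlt]
      exact NNReal.coe_le_coe.2 le_sup_left
    have price_increase (j : Fin m) : (price v (insert a H) j : ℝ) =
        price v H j + (demandSupport (v a) (price v H) j - price v H j : ℝ≥0) := by
      rw [price_insert v hlt, Pi.sup_apply, ← NNReal.coe_add, add_tsub_eq_max]
    have sum_mono (i : ι) :
        ∑ j ∈ A i, (price v H j : ℝ) ≤ ∑ j ∈ A i, (price v (insert a H) j : ℝ) :=
      sum_le_sum fun j _ => price_mono j
    have sum_sum_mono := sum_le_sum fun i (_ : i ∈ H) => sum_mono i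
    have sum_increase : ∑ j, (price v (insert a H) j : ℝ) = ∑ j, (price v H j : ℝ) +
        ∑ j, ((demandSupport (v a) (price v H) j - price v H j : ℝ≥0) : ℝ) := by
      rw [← sum_add_distrib]
      exact sum_congr rfl fun j _ => price_increase j
    rw [sum_insert ha, sum_insert ha, sum_increase]
    linarith [sum_mono a]

theorem sum_val_le_two_mul_sum_price {v : ι → Valuation m} (hv : ∀ i, (v i).IsXOS) (H : Finset ι)
    {A : ι → Finset (Fin m)} (hA : (H : Set ι).PairwiseDisjoint A) :
    ∑ i ∈ H, (v i).val (A i) ≤ 2 * ∑ j, (price v H j : ℝ) := by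
  have sum_bundles_le : ∑ i ∈ H, ∑ j ∈ A i, (price v H j : ℝ) ≤ ∑ j, (price v H j : ℝ) := by
    rw [← sum_biUnion hA]
    exact sum_le_sum_of_subset_of_nonneg (subset_univ _) fun j _ _ => NNReal.coe_nonneg _
  linarith [sum_val_le_sum_price_add_sum_price hv H A]

end Prices

section ExpectedPrices

variable {ι : Type*} [LinearOrder ι] [Fintype ι] {m : ℕ} (v : ι → Valuation m)

theorem expect_price_le_two_mul_expect_sup_bid (S : Finset ι) (j : Fin m) :
    𝔼 C, price v (S \ C) j ≤ 2 * 𝔼 C : Finset ι, C.sup fun i => bid v (S \ C) i j := by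
  have hbid (C D : Finset ι) (i : ι) (h : ∀ l < i, l ∈ C ↔ l ∈ D) :
      bid v (S \ C) i j = bid v (S \ D) i j := by
    rw [bid_congr_of_lt v (H' := S \ D) fun l hl => by simp only [mem_sdiff, h l hl]]
  calc 𝔼 C, price v (S \ C) j ≤ 𝔼 C, univ.sup fun i => bid v (S \ C) i j := by
        gcongr with C
        rw [price_eq_sup_bid, Finset.sup_apply]
        exact sup_mono (subset_univ _)
    _ ≤ 2 * 𝔼 C, (univ ∩ C).sup fun i => bid v (S \ C) i j :=
        expect_sup_le_two_mul_expect_sup_inter hbid univ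
    _ = 2 * 𝔼 C : Finset ι, C.sup fun i => bid v (S \ C) i j := by simp only [univ_inter]

theorem expect_expect_price_le_eight_mul (j : Fin m) :
    𝔼 S, 𝔼 C, price v (S \ C) j ≤
      8 * 𝔼 C, 𝔼 S, soleWinnerValue C S fun i => bid v (S \ C) i j :=
  calc 𝔼 S, 𝔼 C, price v (S \ C) j
      ≤ 𝔼 S : Finset ι, 2 * 𝔼 C : Finset ι, C.sup fun i => bid v (S \ C) i j := by
        gcongr with S
        exact expect_price_le_two_mul_expect_sup_bid v S j
    _ = 2 * 𝔼 C : Finset ι, 𝔼 S : Finset ι, C.sup fun i => bid v (S \ C) i j := by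
        rw [← mul_expect, expect_comm]
    _ ≤ 2 * 𝔼 C : Finset ι, 4 * 𝔼 S, soleWinnerValue C S fun i => bid v (S \ C) i j := by
        gcongr with C
        exact expect_sup_le_four_mul_expect_soleWinnerValue C fun H i => bid v H i j
    _ = 8 * 𝔼 C, 𝔼 S, soleWinnerValue C S fun i => bid v (S \ C) i j := by
        rw [← mul_expect, ← mul_assoc]
        norm_num

variable {v}

theorem sum_val_le_eight_mul_expect_price (hv : ∀ i, (v i).IsXOS) {A : ι → Finset (Fin m)}
    (hA : Pairwise (Function.onFun Disjoint A)) :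
    ∑ i, (v i).val (A i) ≤ 8 * 𝔼 S, 𝔼 C, ∑ j, (price v (S \ C) j : ℝ) :=
  calc ∑ i, (v i).val (A i)
      = 4 * 𝔼 S : Finset ι, 𝔼 C, ∑ i ∈ S \ C, (v i).val (A i) := by
        rw [← two_nsmul_expect_sum,
          expect_congr rfl fun S _ => (two_nsmul_expect_sum_sdiff S _).symm, ← smul_expect,
          smul_smul, nsmul_eq_mul]
        norm_num
    _ ≤ 4 * 𝔼 S : Finset ι, 𝔼 C, 2 * ∑ j, (price v (S \ C) j : ℝ) := by
        gcongr with S _ C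
        exact sum_val_le_two_mul_sum_price hv _ (hA.set_pairwise _)
    _ = 8 * 𝔼 S, 𝔼 C, ∑ j, (price v (S \ C) j : ℝ) := by
        simp only [← mul_expect, ← mul_assoc]
        norm_num

theorem sum_val_le_sixty_four_mul_expect_soleWinnerValue (hv : ∀ i, (v i).IsXOS)
    {A : ι → Finset (Fin m)} (hA : Pairwise (Function.onFun Disjoint A)) :
    ∑ i, (v i).val (A i) ≤ 64 * 𝔼 C, 𝔼 S, ∑ j,
      (soleWinnerValue C S (fun i => bid v (S \ C) i j) : ℝ) := by
  have expect_sum_price_le : 𝔼 S, 𝔼 C, ∑ j, (price v (S \ C) j : ℝ) ≤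
      8 * 𝔼 C, 𝔼 S, ∑ j, (soleWinnerValue C S (fun i => bid v (S \ C) i j) : ℝ) := by
    simp only [expect_sum_comm, mul_sum]
    gcongr with j
    exact_mod_cast expect_expect_price_le_eight_mul v j
  linarith [sum_val_le_eight_mul_expect_price hv hA]

end ExpectedPrices

section Items

variable {ι : Type*} [LinearOrder ι] {m : ℕ}

open Classical in
/-- The items for which buyer `i` beats the sample `S` among the candidates `C`, when the prices
are set by the sampled buyers outside `C`. -/
noncomputable def requestedItems (v : ι → Valuation m) (C S : Finset ι) (i : ι) : Finset (Fin m) :=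
  {j | BeatsSample C S (fun l => bid v (S \ C) l j) i}

open Classical in
/-- The items that only buyer `i` requests among the unsampled buyers. -/
noncomputable def wonItems (v : ι → Valuation m) (C S : Finset ι) (i : ι) : Finset (Fin m) :=
  {j | IsSoleWinner C S (fun l => bid v (S \ C) l j) i}

theorem mem_requestedItems {v : ι → Valuation m} {C S : Finset ι} {i : ι} {j : Fin m} :
    j ∈ requestedItems v C S i ↔ BeatsSample C S (fun l => bid v (S \ C) l j) i := by
  simp only [requestedItems, mem_filter_univ]

theorem mem_wonItems {v : ι → Valuation m} {C S : Finset ι} {i : ι} {j : Fin m} :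
    j ∈ wonItems v C S i ↔ IsSoleWinner C S (fun l => bid v (S \ C) l j) i := by
  simp only [wonItems, mem_filter_univ]

theorem requestedItems_congr {v v' : ι → Valuation m} (C : Finset ι) {S : Finset ι} {i : ι}
    (h : ∀ l ∈ insert i S, v l = v' l) : requestedItems v C S i = requestedItems v' C S i := by
  ext j
  rw [mem_requestedItems, mem_requestedItems]
  refine beatsSample_congr fun l hl => ?_
  have agree : ∀ k ∈ insert l (S \ C), v k = v' k := fun k hk =>
    h k (insert_subset hl (sdiff_subset.trans (subset_insert i S)) hk)
  rw [bid_congr agree]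

theorem wonItems_subset_requestedItems (v : ι → Valuation m) (C S : Finset ι) (i : ι) :
    wonItems v C S i ⊆ requestedItems v C S i :=
  fun _ hj => mem_requestedItems.2 (mem_wonItems.1 hj).2.1

theorem wonItems_of_mem (v : ι → Valuation m) (C : Finset ι) {S : Finset ι} {i : ι} (hi : i ∈ S) :
    wonItems v C S i = ∅ :=
  eq_empty_of_forall_notMem fun _ hj => (mem_wonItems.1 hj).1 hi

theorem disjoint_wonItems_requestedItems (v : ι → Valuation m) (C : Finset ι) {S : Finset ι}
    {i l : ι} (hl : l ∉ S) (hli : l ≠ i) :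
    Disjoint (wonItems v C S i) (requestedItems v C S l) :=
  disjoint_left.2 fun _ hwon hrequested =>
    hli ((mem_wonItems.1 hwon).2.2 l hl (mem_requestedItems.1 hrequested))

theorem sum_soleWinnerValue_le_sum_val_wonItems [Fintype ι] {v : ι → Valuation m}
    (hv : ∀ i, (v i).IsXOS) (C S : Finset ι) :
    ∑ j, (soleWinnerValue C S (fun i => bid v (S \ C) i j) : ℝ) ≤
      ∑ i, (v i).val (wonItems v C S i) :=
  calc ∑ j, (soleWinnerValue C S (fun i => bid v (S \ C) i j) : ℝ)
      = ∑ i, ∑ j ∈ wonItems v C S i, (bid v (S \ C) i j : ℝ) := by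
        simp only [soleWinnerValue, NNReal.coe_sum]
        exact sum_comm' (by simp [mem_wonItems])
    _ ≤ ∑ i, (v i).val (wonItems v C S i) :=
        sum_le_sum fun i _ => (isDemandSupport_demandSupport (hv i) _).sum_le_val _

end Items

section Welfare

namespace Algorithm

variable {n m : ℕ} {alg : Algorithm n m} {ω : alg.Seed} {obs : Fin n → Option (Valuation m)}
  {v : Fin n → Valuation m} {D : Fin n → Finset (Fin m)}

theorem taken_map (hD : ∀ past i, alg.request ω obs past (i, v i) = D i) (L : List (Fin n)) :
    alg.taken ω obs (L.map fun i => (i, v i)) = L.toFinset.biUnion D := by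
  induction L with
  | nil => rfl
  | cons a L ih =>
    rw [List.map_cons, taken, ih, hD, List.toFinset_cons, biUnion_insert, union_comm]

theorem sum_val_le_welfare (hD : ∀ past i, alg.request ω obs past (i, v i) = D i)
    {E : Fin n → Finset (Fin m)} (hED : ∀ i, E i ⊆ D i) {L : List (Fin n)}
    (hL : L.Pairwise fun i l => Disjoint (E i) (D l)) :
    (L.map fun i => (v i).val (E i)).sum ≤ alg.welfare ω obs (L.map fun i => (i, v i)) := by
  induction L with
  | nil => exact le_rfl
  | cons a L ih =>
    obtain ⟨ha, hL⟩ := List.pairwise_cons.1 hL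
    have subset_bundle : E a ⊆ alg.bundle ω obs (L.map fun i => (i, v i)) (a, v a) := by
      rw [bundle, hD, taken_map hD, subset_sdiff, disjoint_biUnion_right]
      exact ⟨hED a, fun l hl => ha l (List.mem_toFinset.1 hl)⟩
    rw [List.map_cons, List.sum_cons, List.map_cons, welfare, add_comm]
    exact add_le_add (ih hL) ((v a).mono subset_bundle)

end Algorithm

end Welfare

section CandidateAlgorithm

variable {n m : ℕ}

/-- The competitive algorithm. The seed is a pair `(T, C)` of independent uniformly random sets
of buyers: `T` serves only to draw the sample size `#T`, and `C` is the set of candidates. An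
unrevealed buyer is given the valuation of the arriving one, which affects no compared bid. -/
noncomputable def candidateAlgorithm (n m : ℕ) : Algorithm n m where
  Seed := Finset (Fin n) × Finset (Fin n)
  prob _ := (2 ^ n * 2 ^ n)⁻¹
  prob_nonneg _ := by positivity
  prob_sum := by
    simp only [sum_const, card_univ, Fintype.card_prod, Fintype.card_finset, Fintype.card_fin,
      nsmul_eq_mul]
    push_cast
    exact mul_inv_cancel₀ (by positivity)
  sampleSize ω := #ω.1
  sampleSize_le ω := card_finset_fin_le ω.1
  request ω obs _ x :=
    let S : Finset (Fin n) := {l | (obs l).isSome}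
    let v : Fin n → Valuation m := fun l => (obs l).getD x.2
    requestedItems v ω.2 S x.1

theorem samplesHalf_candidateAlgorithm (n m : ℕ) : SamplesHalf (candidateAlgorithm n m) := by
  intro k
  have card_eq : #{T : Finset (Fin n) | #T = k} = n.choose k := by
    rw [univ_filter_card_eq, card_powersetCard, card_univ, Fintype.card_fin]
  change ∑ ω : Finset (Fin n) × Finset (Fin n),
    (if #ω.1 = k then ((2 ^ n * 2 ^ n)⁻¹ : ℝ) else 0) = _
  rw [Fintype.sum_prod_type_right]
  simp only [← sum_filter, sum_const, card_eq, card_univ,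
    Fintype.card_finset, Fintype.card_fin, nsmul_eq_mul]
  push_cast
  field_simp

theorem expectedWelfare_candidateAlgorithm (v : Fin n → Valuation m)
    (order : (candidateAlgorithm n m).Seed → Finset (Fin n) → List (Fin n)) :
    expectedWelfare (candidateAlgorithm n m) v order =
      𝔼 C : Finset (Fin n), 𝔼 T : Finset (Fin n), 𝔼 S ∈ powersetCard #T univ,
        (candidateAlgorithm n m).welfare (T, C) (observe v S)
          ((order (T, C) S).map fun i => (i, v i)).reverse := by
  change ∑ ω : Finset (Fin n) × Finset (Fin n), ((2 ^ n * 2 ^ n)⁻¹ : ℝ) * _ = _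
  rw [Fintype.sum_prod_type_right]
  simp only [expect_eq_sum_div_card, card_powersetCard, card_univ,
    Fintype.card_finset, Fintype.card_fin, ← mul_sum, ← sum_div]
  push_cast
  rw [div_div, div_eq_inv_mul]
  rfl

theorem request_candidateAlgorithm (v : Fin n → Valuation m) (T C S : Finset (Fin n))
    (past : List (Arrival n m)) (i : Fin n) :
    (candidateAlgorithm n m).request (T, C) (observe v S) past (i, v i) =
      requestedItems v C S i := by
  have sample_eq : ({l | (observe v S l).isSome} : Finset (Fin n)) = S := by
    ext l
    by_cases hl : l ∈ S <;> simp [observe, hl]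
  have getD_observe (l : Fin n) (hl : l ∈ insert i S) : (observe v S l).getD (v i) = v l := by
    by_cases hlS : l ∈ S
    · rw [observe, if_pos hlS, Option.getD_some]
    · rw [observe, if_neg hlS, Option.getD_none, eq_of_mem_insert_of_notMem hl hlS]
  simp only [candidateAlgorithm, sample_eq]
  exact requestedItems_congr C getD_observe

theorem sum_soleWinnerValue_le_welfare {v : Fin n → Valuation m} (hv : ∀ i, (v i).IsXOS)
    (T C : Finset (Fin n)) {S : Finset (Fin n)} {L : List (Fin n)} (hL : IsArrivalOrder S L) :
    ∑ j, (soleWinnerValue C S (fun i => bid v (S \ C) i j) : ℝ) ≤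
      (candidateAlgorithm n m).welfare (T, C) (observe v S)
        (L.map fun i => (i, v i)).reverse := by
  have nodup_reverse := List.nodup_reverse.2 hL.1
  have pairwise_disjoint :
      L.reverse.Pairwise fun i l => Disjoint (wonItems v C S i) (requestedItems v C S l) :=
    nodup_reverse.imp_of_mem fun _ hl hil =>
      disjoint_wonItems_requestedItems v C ((hL.2 _).1 (List.mem_reverse.1 hl)) hil.symm
  calc ∑ j, (soleWinnerValue C S (fun i => bid v (S \ C) i j) : ℝ)
      ≤ ∑ i, (v i).val (wonItems v C S i) := sum_soleWinnerValue_le_sum_val_wonItems hv C S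
    _ = ∑ i ∈ L.reverse.toFinset, (v i).val (wonItems v C S i) := by
        refine (sum_subset (subset_univ _) fun i _ hi => ?_).symm
        have hiS : i ∈ S := by simpa [hL.2] using hi
        rw [wonItems_of_mem v C hiS, (v i).val_empty]
    _ = (L.reverse.map fun i => (v i).val (wonItems v C S i)).sum :=
        List.sum_toFinset _ nodup_reverse
    _ ≤ (candidateAlgorithm n m).welfare (T, C) (observe v S)
          (L.map fun i => (i, v i)).reverse := by
        rw [← List.map_reverse]
        exact Algorithm.sum_val_le_welfare (request_candidateAlgorithm v T C S)
          (wonItems_subset_requestedItems v C S) pairwise_disjoint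

theorem isCompetitive_candidateAlgorithm (n m : ℕ) :
    IsCompetitive (candidateAlgorithm n m) 64 := by
  intro v hv order horder
  have isXOS (i : Fin n) : (v i).IsXOS := (hv i).elim Valuation.IsSubmodular.isXOS id
  have : Nonempty (Allocation n m) := ⟨fun _ => ∅, fun _ _ _ => disjoint_empty_left _⟩
  let value (C S : Finset (Fin n)) : ℝ :=
    ∑ j, (soleWinnerValue C S (fun i => bid v (S \ C) i j) : ℝ)
  refine ciSup_le fun A => ?_
  calc ∑ i, (v i).val (A.1 i) ≤ 64 * 𝔼 C, 𝔼 S, value C S :=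
        sum_val_le_sixty_four_mul_expect_soleWinnerValue isXOS A.2
    _ = 64 * 𝔼 C, 𝔼 T : Finset (Fin n), 𝔼 S ∈ powersetCard #T univ, value C S := by
        simp only [expect_expect_powersetCard_card]
    _ ≤ 64 * expectedWelfare (candidateAlgorithm n m) v order := by
        rw [expectedWelfare_candidateAlgorithm]
        gcongr with C _ T _ S
        exact sum_soleWinnerValue_le_welfare isXOS T C (horder (T, C) S)

end CandidateAlgorithm

end OrderObliviousSecretary

theorem mainTheorem4 :
    ∃ α : ℝ, 1 ≤ α ∧
      ∃ alg : ∀ n m : ℕ, OrderObliviousSecretary.Algorithm n m,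
        ∀ n m : ℕ, OrderObliviousSecretary.SamplesHalf (alg n m) ∧
          OrderObliviousSecretary.IsCompetitive (alg n m) α :=
  ⟨64, by norm_num, OrderObliviousSecretary.candidateAlgorithm, fun n m =>
    ⟨OrderObliviousSecretary.samplesHalf_candidateAlgorithm n m,
      OrderObliviousSecretary.isCompetitive_candidateAlgorithm n m⟩⟩
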